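/- Let $k\ge 0$ be an integer and let $\mathcal H\subset\mathbb Z^k\setminus\{\mathbf 0\}$. For $x\in\mathbb R$ let $\lVert x\rVert$ denote the distance from $x$ to the nearest integer, and let $\cdot$ be the standard inner product. Call $\mathcal H$ a *van der Corput set* if for every family $(u_{\mathbf n})_{\mathbf n\in\mathbb Z^k}$ of complex numbers of modulus $1$ such that $$\lim_{N_1,\ldots,N_k\to\infty}\frac1{N_1\cdots N_k}\sum_{\mathbf 0\le\mathbf n<(N_1,\ldots,N_k)}u_{\mathbf n+\mathbf h}\overline{u_{\mathbf n}}=0\qquad\text{for all }\mathbf h\in\mathcal H,$$ one has $$\lim_{N_1,\ldots,N_k\to\infty}\frac1{N_1\cdots N_k}\sum_{\mathbf 0\le\mathbf n<(N_1,\ldots,N_k)}u_{\mathbf n}=0;$$ here $N_1,\ldots,N_k$ tend to infinity independently and the sums run over $\mathbf n\in\mathbb Z^k$ with $0\le n_i<N_i$ for all $i$. Call $\mathcal H$ a *Heilbronn set* if for every $\xi\in\mathbb R^k$ and every $\varepsilon>0$ there is an $\mathbf h\in\mathcal H$ with $\lVert\mathbf h\cdot\xi\rVert<\varepsilon$. Let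 $\mathcal T(\mathcal H)$ be the set of real trigonometric polynomials $$T(\mathbf x)=a_0+\sum_{\mathbf h\in\mathcal H}a_{\mathbf h}\cos(2\pi\,\mathbf h\cdot\mathbf x)$$ (with real coefficients, only finitely many of them nonzero) such that $T(\mathbf x)\ge 0$ for all $\mathbf x\in\mathbb R^k$ and $T(\mathbf 0)=1$. Put $$\delta(\mathcal H)=\inf_{T\in\mathcal T(\mathcal H)}a_0,\qquad \gamma(\mathcal H)=\sup_{\xi\in\mathbb R^k}\ \inf_{\mathbf h\in\mathcal H}\lVert\mathbf h\cdot\xi\rVert ,$$ with the convention $\inf\emptyset=+\infty$. Then: 1. $\mathcal H$ is a van der Corput set if and only if $\delta(\mathcal H)=0$. 2. $\mathcal H$ is a Heilbronn set if and only if $\gamma(\mathcal H)=0$. 3. If $\mathcal H\neq\emptyset$, then $\gamma(\mathcal H)\le\delta(\mathcal H)$. 4. If $\mathcal H$ is a van der Corput set, then $\mathcal H$ is a Heilbronn set. -/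

import Mathlib

open Filter Topology

noncomputable section

/-- The inner product `h · x` of an integer vector with a real vector. -/
def latticeDot {k : ℕ} (h : Fin k → ℤ) (x : Fin k → ℝ) : ℝ :=
  ∑ i, (h i : ℝ) * x i

/-- The distance of a real number to the nearest integer. -/
def distInt (x : ℝ) : ℝ := |x - round x|

/-- The average `(N₁ ⋯ N_k)⁻¹ ∑_{0 ≤ n < (N₁, …, N_k)} v n` of a family indexed by `ℤ^k`. -/
def boxAverage {k : ℕ} (v : (Fin k → ℤ) → ℂ) (N : Fin k → ℕ) : ℂ :=
  (∏ i, (N i : ℂ))⁻¹ *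
    ∑ n ∈ Fintype.piFinset (fun i => Finset.Ico (0 : ℤ) (N i : ℤ)), v n

/-- Van der Corput sets. The filter `atTop` on `Fin k → ℕ` (product order) expresses that
`N₁, …, N_k` tend to infinity independently. -/
def IsVanDerCorput {k : ℕ} (H : Set (Fin k → ℤ)) : Prop :=
  ∀ u : (Fin k → ℤ) → ℂ, (∀ n, ‖u n‖ = 1) →
    (∀ h ∈ H, Tendsto (boxAverage fun n => u (n + h) * (starRingEnd ℂ) (u n)) atTop (𝓝 0)) →
    Tendsto (boxAverage u) atTop (𝓝 0)

/-- Heilbronn sets. -/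
def IsHeilbronn {k : ℕ} (H : Set (Fin k → ℤ)) : Prop :=
  ∀ ξ : Fin k → ℝ, ∀ ε : ℝ, 0 < ε → ∃ h ∈ H, distInt (latticeDot h ξ) < ε

/-- The cosine polynomial `a₀ + ∑_h a_h cos (2π h · x)` (finitely many nonzero `a_h`). -/
def cosPoly {k : ℕ} (a₀ : ℝ) (a : (Fin k → ℤ) →₀ ℝ) (x : Fin k → ℝ) : ℝ :=
  a₀ + a.sum fun h c => c * Real.cos (2 * Real.pi * latticeDot h x)

/-- The coefficients `(a₀, a)` define a polynomial of the class `𝒯(H)`: its frequencies lie in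
`H`, it is nonnegative, and its value at `0` is `1`. -/
def IsAdmissible {k : ℕ} (H : Set (Fin k → ℤ)) (a₀ : ℝ) (a : (Fin k → ℤ) →₀ ℝ) : Prop :=
  (a.support : Set (Fin k → ℤ)) ⊆ H ∧ (∀ x, 0 ≤ cosPoly a₀ a x) ∧ cosPoly a₀ a 0 = 1

/-- `δ(H)`, the infimum of the constant terms over `𝒯(H)`, taken in the extended reals. -/
def deltaInf {k : ℕ} (H : Set (Fin k → ℤ)) : EReal :=
  sInf {d : EReal | ∃ (a₀ : ℝ) (a : (Fin k → ℤ) →₀ ℝ), IsAdmissible H a₀ a ∧ d = (a₀ : EReal)}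

/-- `γ(H) = sup_ξ inf_{h ∈ H} ‖h · ξ‖`, taken in the extended reals (so it is `+∞` for the
empty set). -/
def gammaSup {k : ℕ} (H : Set (Fin k → ℤ)) : EReal :=
  ⨆ ξ : Fin k → ℝ, ⨅ h ∈ H, ((distInt (latticeDot h ξ) : ℝ) : EReal)

end

/-! Sufficiency of small constant terms. Let `m` be the box average of `u`. Integrating a
nonnegative `T` against the squared modulus of the exponential sum with coefficients `u n - m`
bounds a combination of correlations below by zero (`cosPoly_corr_nonneg`). The correlation of `u -
m` at `h` is that of `u` minus `‖m‖ ^ 2`, up to boundary terms (`norm_corr_sub_average_le`). Since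
the coefficients of `T` sum to `1`, this gives `‖m‖ ^ 2 ≤ a₀ + o(1)`.

Necessity. Suppose every constant term is at least `ε > 0`. Then any finite combination of the
functions `p + q e(h · x)` with `p / (p + q) < ε` has nonpositive real part somewhere
(`exists_re_sum_nonpos`); otherwise its cosine part, normalized, would be admissible with constant
term `p / (p + q)`. So points `y_t` can be picked one by one, each adding a vector that makes an
obtuse or right angle with the sum so far, and the sums stay `o(t²)` in every coordinate
(`exists_points`). Cut one coordinate axis into blocks `[t², (t+1)²)`. Put `u = 1` on the first `t /
p` points of each block and `u n = s e(n · y_t)` on the rest. All correlations along `H` then tend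
to zero, for `s = 1` and for `s = -1`. If both averages tended to zero, so would half their sum, the
density of the initial parts, which it does not (`not_tendsto_boxAverage_initial`).

The bound `γ ≤ δ` comes from summing `T (n ξ) ≥ 0` against the nonnegative Fourier coefficients of a
tent function supported near the integers (`IsAdmissible.le_constant`). Together with the first
equivalence it makes van der Corput sets Heilbronn. -/

noncomputable section

/-- The character `x ↦ exp (2πi h · x)`. -/
def expDot {k : ℕ} (h : Fin k → ℤ) (x : Fin k → ℝ) : ℂ :=
  Complex.exp ((2 * Real.pi * latticeDot h x : ℝ) * Complex.I)

/-! ### Characters of the torus -/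

section Characters

variable {k : ℕ}

lemma norm_expDot (h : Fin k → ℤ) (x : Fin k → ℝ) : ‖expDot h x‖ = 1 :=
  Complex.norm_exp_ofReal_mul_I _

lemma re_expDot (h : Fin k → ℤ) (x : Fin k → ℝ) :
    (expDot h x).re = Real.cos (2 * Real.pi * latticeDot h x) :=
  Complex.exp_ofReal_mul_I_re _

lemma im_expDot (h : Fin k → ℤ) (x : Fin k → ℝ) :
    (expDot h x).im = Real.sin (2 * Real.pi * latticeDot h x) :=
  Complex.exp_ofReal_mul_I_im _

lemma latticeDot_add (h g : Fin k → ℤ) (x : Fin k → ℝ) :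
    latticeDot (h + g) x = latticeDot h x + latticeDot g x := by
  simp [latticeDot, add_mul, Finset.sum_add_distrib]

lemma latticeDot_zero_left (x : Fin k → ℝ) : latticeDot 0 x = 0 := by simp [latticeDot]

lemma latticeDot_zero_right (h : Fin k → ℤ) : latticeDot h 0 = 0 := by simp [latticeDot]

lemma latticeDot_neg_right (h : Fin k → ℤ) (x : Fin k → ℝ) :
    latticeDot h (-x) = -latticeDot h x := by simp [latticeDot]

lemma latticeDot_smul_right (h : Fin k → ℤ) (c : ℝ) (x : Fin k → ℝ) :
    latticeDot h (c • x) = c * latticeDot h x := by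
  simp only [latticeDot, Finset.mul_sum, Pi.smul_apply, smul_eq_mul]
  exact Finset.sum_congr rfl fun i _ => by ring

lemma expDot_add (h g : Fin k → ℤ) (x : Fin k → ℝ) :
    expDot (h + g) x = expDot h x * expDot g x := by
  rw [expDot, latticeDot_add, expDot, expDot, ← Complex.exp_add]
  push_cast
  ring_nf

lemma expDot_zero_left (x : Fin k → ℝ) : expDot 0 x = 1 := by
  simp [expDot, latticeDot_zero_left]

lemma expDot_mul_conj (h : Fin k → ℤ) (x : Fin k → ℝ) :
    expDot h x * (starRingEnd ℂ) (expDot h x) = 1 := by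
  rw [Complex.mul_conj, Complex.normSq_eq_norm_sq, norm_expDot]
  norm_num

lemma mFourier_coe (h : Fin k → ℤ) (x : Fin k → ℝ) :
    UnitAddTorus.mFourier h (fun i => (x i : UnitAddCircle)) = expDot h x := by
  simp only [UnitAddTorus.mFourier, ContinuousMap.coe_mk, fourier_coe_apply, expDot, latticeDot,
    ← Complex.exp_sum]
  congr 1
  push_cast
  rw [Finset.mul_sum, Finset.sum_mul]
  exact Finset.sum_congr rfl fun i _ => by ring

end Characters

/-! ### Positivity of correlations -/

section Positivity

open MeasureTheory

variable {k : ℕ}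

/-- The normalized Haar measure of the torus. -/
def torusMeasure (k : ℕ) : Measure (UnitAddTorus (Fin k)) :=
  Measure.pi fun _ => AddCircle.haarAddCircle

instance : IsProbabilityMeasure (torusMeasure k) := by
  unfold torusMeasure; infer_instance

lemma integral_fourier_eq_ite (n : ℤ) :
    ∫ x : UnitAddCircle, fourier n x ∂AddCircle.haarAddCircle = if n = 0 then 1 else 0 := by
  split_ifs with h
  · simp [h]
  · exact integral_eq_zero_of_add_right_eq_neg (μ := AddCircle.haarAddCircle)
      (fourier_add_half_inv_index h one_pos)

lemma integral_mFourier_eq_ite (n : Fin k → ℤ) :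
    ∫ x, UnitAddTorus.mFourier n x ∂torusMeasure k = if n = 0 then 1 else 0 := by
  simp only [UnitAddTorus.mFourier, ContinuousMap.coe_mk, torusMeasure]
  rw [integral_fintype_prod_eq_prod (fun i (x : UnitAddCircle) => (fourier (n i) x : ℂ))]
  simp_rw [integral_fourier_eq_ite]
  rw [Finset.prod_ite_zero]
  simp [funext_iff]

/-- Positivity of the correlations of a finitely supported family against the coefficients of a
trigonometric polynomial with nonnegative real part. -/
theorem re_sum_mul_corr_nonneg {ι : Type*} (s : Finset ι) (c : ι → ℂ) (h : ι → Fin k → ℤ)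
    (hG : ∀ x : Fin k → ℝ, 0 ≤ (∑ i ∈ s, c i * expDot (h i) x).re)
    (B : Finset (Fin k → ℤ)) (U : (Fin k → ℤ) → ℂ) :
    0 ≤ (∑ i ∈ s, c i * ∑ n ∈ B with n + h i ∈ B,
      U (n + h i) * (starRingEnd ℂ) (U n)).re := by
  have hint : ∀ n : Fin k → ℤ,
      Integrable (fun x => (UnitAddTorus.mFourier n x : ℂ)) (torusMeasure k) := fun n =>
    (UnitAddTorus.mFourier n).continuous.integrable_of_hasCompactSupport
      (HasCompactSupport.of_compactSpace _)
  -- This is the trigonometric polynomial times the squared modulus of an exponential sum, expanded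
  -- so that orthogonality keeps only the terms with `m = n + h i`.
  set F : UnitAddTorus (Fin k) → ℂ := fun x => ∑ i ∈ s, ∑ n ∈ B, ∑ m ∈ B,
    c i * (U m * (starRingEnd ℂ) (U n)) * UnitAddTorus.mFourier (h i + n + -m) x with hF
  have hFint : Integrable F (torusMeasure k) :=
    integrable_finsetSum _ fun i _ => integrable_finsetSum _ fun n _ =>
      integrable_finsetSum _ fun m _ => (hint _).const_mul _
  have hval : ∫ x, F x ∂torusMeasure k = ∑ i ∈ s, c i * ∑ n ∈ B with n + h i ∈ B,
      U (n + h i) * (starRingEnd ℂ) (U n) := by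
    rw [integral_finsetSum _ fun i _ => integrable_finsetSum _ fun n _ =>
      integrable_finsetSum _ fun m _ => (hint _).const_mul _]
    refine Finset.sum_congr rfl fun i _ => ?_
    rw [integral_finsetSum _ fun n _ =>
      integrable_finsetSum _ fun m _ => (hint _).const_mul _, Finset.mul_sum, Finset.sum_filter]
    refine Finset.sum_congr rfl fun n _ => ?_
    rw [integral_finsetSum _ fun m _ => (hint _).const_mul _]
    simp_rw [integral_const_mul, integral_mFourier_eq_ite, ← sub_eq_add_neg, sub_eq_zero]
    simp [add_comm (h i) n]
  have hpos : ∀ x, 0 ≤ (F x).re := by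
    intro x
    obtain ⟨y, rfl⟩ : ∃ y : Fin k → ℝ, x = fun i => (y i : UnitAddCircle) := by
      choose y hy using fun i => QuotientAddGroup.mk_surjective (x i)
      exact ⟨y, funext fun i => (hy i).symm⟩
    set P : ℂ := ∑ m ∈ B, U m * (starRingEnd ℂ) (expDot m y) with hP
    have : F (fun i => (y i : UnitAddCircle)) =
        (∑ i ∈ s, c i * expDot (h i) y) * ((‖P‖ ^ 2 : ℝ) : ℂ) := by
      rw [← Complex.normSq_eq_norm_sq, Complex.normSq_eq_conj_mul_self, hP, map_sum,
        Finset.sum_mul_sum, Finset.sum_mul]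
      refine Finset.sum_congr rfl fun i _ => ?_
      rw [Finset.mul_sum]
      refine Finset.sum_congr rfl fun n _ => ?_
      rw [Finset.mul_sum]
      refine Finset.sum_congr rfl fun m _ => ?_
      rw [UnitAddTorus.mFourier_add, UnitAddTorus.mFourier_add, UnitAddTorus.mFourier_neg,
        mFourier_coe, mFourier_coe, mFourier_coe, map_mul, Complex.conj_conj]
      ring
    rw [this, Complex.re_mul_ofReal]
    exact mul_nonneg (hG y) (by positivity)
  rw [← hval]
  have := integral_re hFint
  simp only [RCLike.re_eq_complex_re] at this
  rw [← this]
  exact integral_nonneg hpos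

theorem cosPoly_corr_nonneg {a₀ : ℝ} {a : (Fin k → ℤ) →₀ ℝ} (hT : ∀ x, 0 ≤ cosPoly a₀ a x)
    (B : Finset (Fin k → ℤ)) (U : (Fin k → ℤ) → ℂ) :
    0 ≤ a₀ * ∑ n ∈ B, ‖U n‖ ^ 2 + a.sum fun h c =>
      c * (∑ n ∈ B with n + h ∈ B, U (n + h) * (starRingEnd ℂ) (U n)).re := by
  -- The index `none` carries the constant term, as the coefficient of frequency `0`.
  have := re_sum_mul_corr_nonneg (Finset.insertNone a.support)
    (fun o => ((o.elim a₀ a : ℝ) : ℂ)) (fun o => o.elim 0 id) (fun x => ?_) B U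
  · rw [Finset.sum_insertNone] at this
    simp only [Option.elim, add_zero, Complex.add_re, Complex.re_ofReal_mul, Complex.re_sum,
      Finset.filter_mem_eq_inter, Finset.inter_self, Complex.mul_conj, Complex.ofReal_re, id,
      Complex.normSq_eq_norm_sq] at this
    simp only [Finsupp.sum, Complex.re_sum]
    convert this using 2
    refine Finset.sum_congr rfl fun h _ => ?_
    congr!
  · rw [Finset.sum_insertNone]
    simpa [expDot_zero_left, re_expDot, cosPoly, Finsupp.sum] using hT x

/-- Test positivity on a single point mass: every nonzero shift moves it off itself, so only the
constant term survives. -/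
lemma IsAdmissible.constant_nonneg {H : Set (Fin k → ℤ)} (hH : (0 : Fin k → ℤ) ∉ H) {a₀ : ℝ}
    {a : (Fin k → ℤ) →₀ ℝ} (hT : IsAdmissible H a₀ a) : 0 ≤ a₀ := by
  have := cosPoly_corr_nonneg hT.2.1 {0} fun _ => 1
  have hsum : (a.sum fun h c => c * (∑ n ∈ ({0} : Finset (Fin k → ℤ)) with n + h ∈
      ({0} : Finset (Fin k → ℤ)), (1 : ℂ) * (starRingEnd ℂ) 1).re) = 0 := by
    refine Finset.sum_eq_zero fun h hh => ?_
    have : h ≠ 0 := fun h0 => hH (h0 ▸ hT.1 hh)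
    simp [Finset.filter_singleton, this]
  rw [hsum] at this
  simpa using this

lemma cosPoly_zero (a₀ : ℝ) (a : (Fin k → ℤ) →₀ ℝ) :
    cosPoly a₀ a 0 = a₀ + a.sum fun _ c => c := by
  simp [cosPoly, latticeDot_zero_right]

end Positivity

/-! ### Box averages and boundary effects -/

section BoxAverage

variable {k : ℕ}

/-- The box `0 ≤ n < (N₁, …, N_k)`. -/
def box (N : Fin k → ℕ) : Finset (Fin k → ℤ) :=
  Fintype.piFinset fun i => Finset.Ico (0 : ℤ) (N i : ℤ)

lemma mem_box {N : Fin k → ℕ} {n : Fin k → ℤ} :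
    n ∈ box N ↔ ∀ i, n i ∈ Finset.Ico (0 : ℤ) (N i : ℤ) := Fintype.mem_piFinset

lemma card_box (N : Fin k → ℕ) : (box N).card = ∏ i, N i := by simp [box]

lemma boxAverage_eq (v : (Fin k → ℤ) → ℂ) (N : Fin k → ℕ) :
    boxAverage v N = ((box N).card : ℂ)⁻¹ * ∑ n ∈ box N, v n := by
  rw [card_box]; push_cast; rfl

lemma card_box_pos {N : Fin k → ℕ} (hN : ∀ i, 0 < N i) : 0 < (box N).card := by
  rw [card_box]; exact Finset.prod_pos fun i _ => hN i

lemma eventually_forall_pos : ∀ᶠ N : Fin k → ℕ in atTop, ∀ i, 0 < N i := by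
  filter_upwards [eventually_ge_atTop (1 : Fin k → ℕ)] with N hN i using hN i

lemma norm_boxAverage_le {v : (Fin k → ℤ) → ℂ} {w : (Fin k → ℤ) → ℝ} (h : ∀ n, ‖v n‖ ≤ w n)
    (N : Fin k → ℕ) : ‖boxAverage v N‖ ≤ ((box N).card : ℝ)⁻¹ * ∑ n ∈ box N, w n := by
  rw [boxAverage_eq, norm_mul, norm_inv, Complex.norm_natCast]
  gcongr
  exact (norm_sum_le _ _).trans (Finset.sum_le_sum fun n _ => h n)

lemma norm_boxAverage_le_of_le {v : (Fin k → ℤ) → ℂ} {C : ℝ} (hC : 0 ≤ C) (h : ∀ n, ‖v n‖ ≤ C)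
    (N : Fin k → ℕ) : ‖boxAverage v N‖ ≤ C := by
  refine (norm_boxAverage_le h N).trans ?_
  rw [Finset.sum_const, nsmul_eq_mul, ← mul_assoc]
  exact mul_le_of_le_one_left hC (inv_mul_le_one)

lemma boxAverage_sub (v w : (Fin k → ℤ) → ℂ) (N : Fin k → ℕ) :
    boxAverage (fun n => v n - w n) N = boxAverage v N - boxAverage w N := by
  simp only [boxAverage_eq, Finset.sum_sub_distrib, mul_sub]

lemma boxAverage_add (v w : (Fin k → ℤ) → ℂ) (N : Fin k → ℕ) :
    boxAverage (fun n => v n + w n) N = boxAverage v N + boxAverage w N := by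
  simp only [boxAverage_eq, Finset.sum_add_distrib, mul_add]

lemma boxAverage_const_mul (c : ℂ) (v : (Fin k → ℤ) → ℂ) (N : Fin k → ℕ) :
    boxAverage (fun n => c * v n) N = c * boxAverage v N := by
  simp only [boxAverage_eq, ← Finset.mul_sum]
  ring

lemma boxAverage_const (c : ℂ) {N : Fin k → ℕ} (hN : ∀ i, 0 < N i) :
    boxAverage (fun _ => c) N = c := by
  have := (card_box_pos hN).ne'
  rw [boxAverage_eq, Finset.sum_const, nsmul_eq_mul]
  field_simp

/-- The average over a box of a function of one coordinate. -/
lemma average_box_coord {K : Type*} [Field K] [CharZero K] (i₀ : Fin k) (g : ℤ → K)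
    {N : Fin k → ℕ} (hN : ∀ i, 0 < N i) :
    ((box N).card : K)⁻¹ * ∑ n ∈ box N, g (n i₀) =
      (N i₀ : K)⁻¹ * ∑ m ∈ Finset.Ico (0 : ℤ) (N i₀), g m := by
  have h1 : ∑ n ∈ box N, g (n i₀) =
      (∏ i ∈ Finset.univ.erase i₀, (N i : K)) * ∑ m ∈ Finset.Ico (0 : ℤ) (N i₀), g m := by
    have := Finset.prod_univ_sum (fun i => Finset.Ico (0 : ℤ) (N i : ℤ))
      (fun i j => if i = i₀ then g j else 1)
    rw [← Finset.mul_prod_erase _ _ (Finset.mem_univ i₀), mul_comm] at this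
    rw [box]
    refine Eq.trans (Finset.sum_congr rfl fun n _ => ?_) (this.symm.trans ?_)
    · simp
    · congr 1
      · refine Finset.prod_congr rfl fun i hi => ?_
        simp [Finset.ne_of_mem_erase hi]
      · simp
  rw [h1, card_box, Nat.cast_prod, ← Finset.mul_prod_erase _ _ (Finset.mem_univ i₀)]
  have h2 : (N i₀ : K) ≠ 0 := by exact_mod_cast (hN i₀).ne'
  have h3 : (∏ i ∈ Finset.univ.erase i₀, (N i : K)) ≠ 0 :=
    Finset.prod_ne_zero_iff.2 fun i _ => by exact_mod_cast (hN i).ne'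
  field_simp

/-- The proportion of the points of a box which leave it under translation by `h`. -/
def escape (h : Fin k → ℤ) (N : Fin k → ℕ) : ℝ :=
  ((box N).card : ℝ)⁻¹ * ((box N).filter fun n => n + h ∉ box N).card

lemma card_escape_Ico_le (a : ℤ) (M : ℕ) :
    ((Finset.Ico (0 : ℤ) M).filter fun m => m + a ∉ Finset.Ico (0 : ℤ) M).card ≤ a.natAbs := by
  have : ((Finset.Ico (0 : ℤ) M).filter fun m => m + a ∉ Finset.Ico (0 : ℤ) M) ⊆
      if 0 ≤ a then Finset.Ico ((M : ℤ) - a) M else Finset.Ico 0 (-a) := by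
    intro m hm
    simp only [Finset.mem_filter, Finset.mem_Ico, not_and, not_lt] at hm
    split_ifs <;> simp only [Finset.mem_Ico] <;> omega
  refine (Finset.card_le_card this).trans ?_
  split_ifs <;> simp only [Int.card_Ico] <;> omega

/-- Union bound over coordinates: a point leaves the box only if some coordinate leaves its
interval, and at most `|h i|` values of that coordinate do so. -/
lemma escape_le (h : Fin k → ℤ) {N : Fin k → ℕ} (hN : ∀ i, 0 < N i) :
    escape h N ≤ ∑ i, (N i : ℝ)⁻¹ * (h i).natAbs := by
  have h1 : (((box N).filter fun n => n + h ∉ box N).card : ℝ) ≤ ∑ n ∈ box N, ∑ i,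
      if n i + h i ∉ Finset.Ico (0 : ℤ) (N i) then (1 : ℝ) else 0 := by
    rw [Finset.card_filter]
    push_cast
    refine Finset.sum_le_sum fun n _ => ?_
    by_cases hn : n + h ∈ box N
    · rw [if_neg (not_not.2 hn)]
      exact Finset.sum_nonneg fun j _ => by positivity
    · rw [if_pos hn]
      obtain ⟨i, hi⟩ := not_forall.1 (mt mem_box.2 hn)
      refine le_trans ?_ (Finset.single_le_sum (f := fun i =>
        if n i + h i ∉ Finset.Ico (0 : ℤ) (N i) then (1 : ℝ) else 0)
        (fun j _ => by positivity) (Finset.mem_univ i))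
      exact (if_pos hi).ge
  rw [Finset.sum_comm] at h1
  rw [escape]
  refine (mul_le_mul_of_nonneg_left h1 (by positivity)).trans ?_
  rw [Finset.mul_sum]
  refine Finset.sum_le_sum fun i _ => ?_
  rw [average_box_coord i (fun m => if m + h i ∉ Finset.Ico (0 : ℤ) (N i) then (1 : ℝ) else 0) hN,
    Finset.sum_boole]
  gcongr
  exact card_escape_Ico_le _ _

lemma escape_nonneg (h : Fin k → ℤ) (N : Fin k → ℕ) : 0 ≤ escape h N := by
  unfold escape; positivity

lemma tendsto_eval_atTop_atTop (i : Fin k) :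
    Tendsto (fun N : Fin k → ℕ => N i) atTop atTop :=
  tendsto_atTop.2 fun b => by
    filter_upwards [eventually_ge_atTop (fun _ => b : Fin k → ℕ)] with N hN using hN i

lemma tendsto_escape (h : Fin k → ℤ) : Tendsto (escape h) atTop (𝓝 0) := by
  have h1 : Tendsto (fun N : Fin k → ℕ => ∑ i, (N i : ℝ)⁻¹ * (h i).natAbs) atTop (𝓝 0) := by
    rw [← Finset.sum_const_zero (s := (Finset.univ : Finset (Fin k)))]
    refine tendsto_finsetSum _ fun i _ => ?_
    rw [← zero_mul ((h i).natAbs : ℝ)]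
    exact ((tendsto_inv_atTop_nhds_zero_nat (𝕜 := ℝ)).comp
      (tendsto_eval_atTop_atTop i)).mul_const _
  refine tendsto_of_tendsto_of_tendsto_of_le_of_le' tendsto_const_nhds h1
    (Eventually.of_forall (escape_nonneg h)) ?_
  filter_upwards [eventually_forall_pos] with N hN using escape_le h hN

lemma norm_inner_sub_boxAverage_le (h : Fin k → ℤ) {w : (Fin k → ℤ) → ℂ} {C : ℝ}
    (hw : ∀ n, ‖w n‖ ≤ C) (N : Fin k → ℕ) :
    ‖((box N).card : ℂ)⁻¹ * (∑ n ∈ box N with n + h ∈ box N, w n) - boxAverage w N‖ ≤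
      C * escape h N := by
  rw [boxAverage_eq, ← mul_sub, ← Finset.sum_filter_add_sum_filter_not (box N)
    (fun n => n + h ∈ box N) w, sub_add_cancel_left, norm_mul, norm_neg, norm_inv,
    Complex.norm_natCast, escape, ← mul_assoc, mul_comm C, mul_assoc]
  gcongr
  refine (norm_sum_le _ _).trans ((Finset.sum_le_sum fun n _ => hw n).trans_eq ?_)
  rw [Finset.sum_const, nsmul_eq_mul, mul_comm]

/-- Averages of bounded families are asymptotically invariant under translation. -/
lemma norm_boxAverage_shift_sub_le (h : Fin k → ℤ) {w : (Fin k → ℤ) → ℂ} {C : ℝ}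
    (hw : ∀ n, ‖w n‖ ≤ C) (N : Fin k → ℕ) :
    ‖boxAverage (fun n => w (n + h)) N - boxAverage w N‖ ≤
      C * escape h N + C * escape (-h) N := by
  have h1 := norm_inner_sub_boxAverage_le h (w := fun n => w (n + h)) (fun n => hw _) N
  have h2 := norm_inner_sub_boxAverage_le (-h) hw N
  have h3 : ∑ n ∈ box N with n + h ∈ box N, w (n + h) = ∑ n ∈ box N with n + -h ∈ box N, w n := by
    refine Finset.sum_nbij' (· + h) (· + -h) ?_ ?_ ?_ ?_ ?_ <;>
      simp +contextual [add_assoc]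
  rw [h3, norm_sub_rev] at h1
  exact (norm_sub_le_norm_sub_add_norm_sub _ _ _).trans (add_le_add h1 h2)

end BoxAverage

/-! ### Small constant terms imply the van der Corput property -/

section Sufficiency

variable {k : ℕ}

/-- The correlations of a family of unimodular numbers with its average removed. -/
lemma norm_corr_sub_average_le {u : (Fin k → ℤ) → ℂ} (hu : ∀ n, ‖u n‖ = 1) (h : Fin k → ℤ)
    {N : Fin k → ℕ} (hN : ∀ i, 0 < N i) :
    ‖((box N).card : ℂ)⁻¹ * (∑ n ∈ box N with n + h ∈ box N, (u (n + h) - boxAverage u N) *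
        (starRingEnd ℂ) (u n - boxAverage u N)) -
      (boxAverage (fun n => u (n + h) * (starRingEnd ℂ) (u n)) N -
        ((‖boxAverage u N‖ ^ 2 : ℝ) : ℂ))‖ ≤ 5 * escape h N + escape (-h) N := by
  set m := boxAverage u N with hm
  have hm1 : ‖m‖ ≤ 1 := norm_boxAverage_le_of_le zero_le_one (fun n => (hu n).le) N
  have hU : ∀ n, ‖u n - m‖ ≤ 2 := fun n => (norm_sub_le _ _).trans (by rw [hu]; linarith)
  -- Products of two factors of norm at most `2` give the constant `4`; translating the average
  -- below adds one more `escape h N`, hence the `5`.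
  have h1 := norm_inner_sub_boxAverage_le h
    (w := fun n => (u (n + h) - m) * (starRingEnd ℂ) (u n - m)) (C := 4) (fun n => by
      rw [norm_mul, RCLike.norm_conj]
      nlinarith [hU n, hU (n + h), norm_nonneg (u n - m), norm_nonneg (u (n + h) - m)]) N
  have h2 := norm_boxAverage_shift_sub_le h (fun n => (hu n).le) N
  have h3 : boxAverage (fun n => (u (n + h) - m) * (starRingEnd ℂ) (u n - m)) N =
      boxAverage (fun n => u (n + h) * (starRingEnd ℂ) (u n)) N - ((‖m‖ ^ 2 : ℝ) : ℂ) -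
        (starRingEnd ℂ) m * (boxAverage (fun n => u (n + h)) N - m) := by
    have hconj : boxAverage (fun n => (starRingEnd ℂ) (u n)) N = (starRingEnd ℂ) m := by
      rw [hm, boxAverage_eq, boxAverage_eq, map_mul, map_sum, map_inv₀, Complex.conj_natCast]
    have hexp : (fun n => (u (n + h) - m) * (starRingEnd ℂ) (u n - m)) = fun n =>
        (u (n + h) * (starRingEnd ℂ) (u n) - m * (starRingEnd ℂ) (u n)) -
          ((starRingEnd ℂ) m * u (n + h) - m * (starRingEnd ℂ) m) := by
      funext n; rw [map_sub]; ring
    rw [hexp, boxAverage_sub, boxAverage_sub, boxAverage_sub, boxAverage_const_mul,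
      boxAverage_const_mul, boxAverage_const _ hN, hconj, ← Complex.normSq_eq_norm_sq,
      ← Complex.mul_conj]
    ring
  have h4 : ‖(starRingEnd ℂ) m * (boxAverage (fun n => u (n + h)) N - m)‖ ≤
      escape h N + escape (-h) N := by
    rw [norm_mul, RCLike.norm_conj]
    refine (mul_le_of_le_one_left (norm_nonneg _) hm1).trans (by simpa using h2)
  rw [h3] at h1
  have h5 := norm_sub_le (((box N).card : ℂ)⁻¹ * (∑ n ∈ box N with n + h ∈ box N,
    (u (n + h) - m) * (starRingEnd ℂ) (u n - m)) - (boxAverage (fun n => u (n + h) *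
      (starRingEnd ℂ) (u n)) N - ((‖m‖ ^ 2 : ℝ) : ℂ) -
        (starRingEnd ℂ) m * (boxAverage (fun n => u (n + h)) N - m)))
    ((starRingEnd ℂ) m * (boxAverage (fun n => u (n + h)) N - m))
  refine le_trans (le_of_eq ?_) (h5.trans (by linarith))
  congr 1
  ring

/-- If the constant terms of admissible polynomials are arbitrarily small, the set of frequencies
is a van der Corput set. -/
theorem isVanDerCorput_of_forall_exists {H : Set (Fin k → ℤ)} (h0 : (0 : Fin k → ℤ) ∉ H)
    (hH : ∀ ε : ℝ, 0 < ε → ∃ a₀ a, IsAdmissible H a₀ a ∧ a₀ < ε) : IsVanDerCorput H := by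
  intro u hu hcorr
  rw [Metric.tendsto_nhds]
  intro ε hε
  -- The argument ends in `‖m‖ ^ 2 ≤ a₀ + E N`, so `a₀` has to be below `ε ^ 2`.
  obtain ⟨a₀, a, hT, ha₀⟩ := hH (ε ^ 2) (by positivity)
  have ha₀_nonneg := hT.constant_nonneg h0
  have hA : a₀ + a.sum (fun _ c => c) = 1 := cosPoly_zero a₀ a ▸ hT.2.2
  set E : (Fin k → ℕ) → ℝ := fun N => ∑ h ∈ a.support, |a h| *
    (‖boxAverage (fun n => u (n + h) * (starRingEnd ℂ) (u n)) N‖ +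
      (5 * escape h N + escape (-h) N)) with hE
  have hE0 : Tendsto E atTop (𝓝 0) := by
    rw [← Finset.sum_const_zero (s := a.support)]
    refine tendsto_finsetSum _ fun h hh => ?_
    have h1 := ((hcorr h (hT.1 hh)).norm.add
      (((tendsto_escape h).const_mul 5).add (tendsto_escape (-h)))).const_mul |a h|
    simpa using h1
  filter_upwards [eventually_forall_pos,
    hE0.eventually (gt_mem_nhds (sub_pos.2 ha₀))] with N hN hEN
  rw [dist_zero_right]
  set m := boxAverage u N with hm
  have hV : (0 : ℝ) < (box N).card := by exact_mod_cast card_box_pos hN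
  have hpos := cosPoly_corr_nonneg hT.2.1 (box N) (fun n => u n - m)
  have hsq : ((box N).card : ℝ)⁻¹ * ∑ n ∈ box N, ‖u n - m‖ ^ 2 ≤ 1 - ‖m‖ ^ 2 := by
    -- At shift `0` nothing escapes, so the error bound vanishes and the estimate becomes the
    -- variance identity.
    have h0 := norm_corr_sub_average_le hu 0 hN
    have hesc : escape (0 : Fin k → ℤ) N = 0 := by simp [escape]
    rw [neg_zero, hesc] at h0
    simp only [add_zero, Finset.filter_mem_eq_inter, Finset.inter_self, ← hm, Complex.mul_conj,
      Complex.normSq_eq_norm_sq, hu, one_pow, Complex.ofReal_one, boxAverage_const _ hN,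
      mul_zero] at h0
    have h1 := sub_eq_zero.1 (norm_le_zero_iff.1 h0)
    refine le_of_eq (Complex.ofReal_injective ?_)
    push_cast at h1 ⊢
    exact h1
  have hterm : ∀ h ∈ a.support, ((box N).card : ℝ)⁻¹ * (a h * (∑ n ∈ box N with n + h ∈ box N,
      (u (n + h) - m) * (starRingEnd ℂ) (u n - m)).re) ≤ |a h| *
      (‖boxAverage (fun n => u (n + h) * (starRingEnd ℂ) (u n)) N‖ +
      (5 * escape h N + escape (-h) N)) - a h * ‖m‖ ^ 2 := by
    intro h _
    have h1 := norm_corr_sub_average_le hu h hN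
    rw [← hm] at h1
    set S := ∑ n ∈ box N with n + h ∈ box N, (u (n + h) - m) * (starRingEnd ℂ) (u n - m)
    set r := boxAverage (fun n => u (n + h) * (starRingEnd ℂ) (u n)) N
    have h2 : |((box N).card : ℝ)⁻¹ * S.re + ‖m‖ ^ 2| ≤
        ‖r‖ + (5 * escape h N + escape (-h) N) := by
      have h3 := (Complex.abs_re_le_norm _).trans ((norm_add_le
        (((box N).card : ℂ)⁻¹ * S - (r - ((‖m‖ ^ 2 : ℝ) : ℂ))) r).trans (add_le_add_left h1 _))
      have h4 : (((box N).card : ℂ)⁻¹ * S - (r - ((‖m‖ ^ 2 : ℝ) : ℂ)) + r).re =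
          ((box N).card : ℝ)⁻¹ * S.re + ‖m‖ ^ 2 := by
        rw [show ((box N).card : ℂ)⁻¹ * S - (r - ((‖m‖ ^ 2 : ℝ) : ℂ)) + r =
          ((((box N).card : ℝ)⁻¹ : ℝ) : ℂ) * S + ((‖m‖ ^ 2 : ℝ) : ℂ) by push_cast; ring,
          Complex.add_re, Complex.re_ofReal_mul, Complex.ofReal_re]
      rw [h4] at h3
      linarith
    have h5 := (le_abs_self _).trans ((abs_mul (a h) _).trans_le
      (mul_le_mul_of_nonneg_left h2 (abs_nonneg (a h))))
    linarith
  have hfin : 0 ≤ a₀ * (1 - ‖m‖ ^ 2) + (E N - (1 - a₀) * ‖m‖ ^ 2) := by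
    have h1 := mul_nonneg (inv_pos.2 hV).le hpos
    rw [mul_add, Finsupp.sum] at h1
    have h2 := Finset.sum_le_sum hterm
    rw [Finset.sum_sub_distrib, ← Finset.sum_mul, ← Finset.mul_sum] at h2
    change _ ≤ E N - _ at h2
    rw [Finsupp.sum] at hA
    rw [show ∑ h ∈ a.support, a h = 1 - a₀ by linarith] at h2
    have h3 := mul_le_mul_of_nonneg_left hsq ha₀_nonneg
    linarith
  nlinarith [norm_nonneg m]

end Sufficiency

/-! ### Tent functions and the comparison of γ with δ -/

section Gamma

/-- Fourier series of the second Bernoulli polynomial; the term `n = 0` is zero because `1 / 0 = 0`.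
-/
lemma hasSum_cos_div_sq {x : ℝ} (hx : x ∈ Set.Icc (0 : ℝ) 1) :
    HasSum (fun n : ℕ => 1 / (n : ℝ) ^ 2 * Real.cos (2 * Real.pi * n * x))
      (Real.pi ^ 2 * (x ^ 2 - x + 1 / 6)) := by
  have := hasSum_one_div_nat_pow_mul_cos one_ne_zero hx
  convert! this using 1
  have h2 := bernoulliFun_two x
  rw [bernoulliFun] at h2
  rw [mul_one, h2, Nat.factorial_two]
  push_cast
  ring

lemma distInt_le_half (x : ℝ) : distInt x ≤ 1 / 2 := abs_sub_round x

lemma distInt_nonneg (x : ℝ) : 0 ≤ distInt x := abs_nonneg _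

lemma le_fract_of_le_distInt {c x : ℝ} (h : c ≤ distInt x) :
    c ≤ Int.fract x ∧ Int.fract x ≤ 1 - c := by
  rw [distInt, abs_sub_round_eq_min, le_min_iff] at h
  exact ⟨h.1, by linarith [h.2]⟩

lemma cos_two_pi_mul_fract (n : ℕ) (x : ℝ) :
    Real.cos (2 * Real.pi * n * Int.fract x) = Real.cos (2 * Real.pi * n * x) := by
  have : 2 * Real.pi * n * x =
      2 * Real.pi * n * Int.fract x + ((n * ⌊x⌋ : ℤ) : ℝ) * (2 * Real.pi) := by
    conv_lhs => rw [← Int.fract_add_floor x]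
    push_cast
    ring
  rw [this, Real.cos_add_int_mul_two_pi]

/-- The Fourier series of a tent function, evaluated off its support. -/
lemma hasSum_tent_of_le_distInt {c x : ℝ} (hc : 0 ≤ c) (hx : c ≤ distInt x) :
    HasSum (fun n : ℕ => 1 / (n : ℝ) ^ 2 * (1 - Real.cos (2 * Real.pi * n * c)) *
      Real.cos (2 * Real.pi * n * x)) (-(Real.pi ^ 2 * c ^ 2)) := by
  obtain ⟨h1, h2⟩ := le_fract_of_le_distInt hx
  have h3 := Int.fract_nonneg x
  have h4 := Int.fract_lt_one x
  -- The tent is a second difference of the Bernoulli function; off its support both shifts by `c`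
  -- stay inside `[0, 1]`, so one quadratic formula serves all three terms.
  have := (hasSum_cos_div_sq (x := Int.fract x) ⟨h3, h4.le⟩).sub
    (((hasSum_cos_div_sq (x := Int.fract x + c) ⟨by linarith, by linarith⟩).add
      (hasSum_cos_div_sq (x := Int.fract x - c) ⟨by linarith, by linarith⟩)).div_const 2)
  convert! this using 1
  · funext n
    rw [← cos_two_pi_mul_fract n x, mul_add, mul_sub (2 * Real.pi * n), Real.cos_add, Real.cos_sub]
    ring
  · ring

/-- The Fourier series of a tent function, evaluated at its peak. -/
lemma hasSum_tent_zero {c : ℝ} (hc : c ∈ Set.Icc (0 : ℝ) 1) :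
    HasSum (fun n : ℕ => 1 / (n : ℝ) ^ 2 * (1 - Real.cos (2 * Real.pi * n * c)))
      (Real.pi ^ 2 * (c - c ^ 2)) := by
  have := (hasSum_cos_div_sq (x := 0) (by simp)).sub (hasSum_cos_div_sq hc)
  convert! this using 1
  · funext n
    simp
    ring
  · ring

/-- The constant term of an admissible polynomial is at least any lower bound for the distances
`‖h · ξ‖`. -/
theorem IsAdmissible.le_constant {k : ℕ} {H : Set (Fin k → ℤ)} {a₀ : ℝ} {a : (Fin k → ℤ) →₀ ℝ}
    (hT : IsAdmissible H a₀ a) {ξ : Fin k → ℝ} {c : ℝ} (hc : 0 < c) (hc2 : c ≤ 1 / 2)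
    (hξ : ∀ h ∈ H, c ≤ distInt (latticeDot h ξ)) : c ≤ a₀ := by
  have hA : a₀ + a.sum (fun _ c => c) = 1 := cosPoly_zero a₀ a ▸ hT.2.2
  have h0 := (hasSum_tent_zero (c := c) ⟨hc.le, by linarith⟩).mul_left a₀
  have h1 : HasSum (fun n : ℕ => ∑ h ∈ a.support, a h * (1 / (n : ℝ) ^ 2 *
      (1 - Real.cos (2 * Real.pi * n * c)) * Real.cos (2 * Real.pi * n * latticeDot h ξ)))
      (∑ h ∈ a.support, a h * (-(Real.pi ^ 2 * c ^ 2))) :=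
    hasSum_sum fun h hh => (hasSum_tent_of_le_distInt hc.le (hξ h (hT.1 hh))).mul_left (a h)
  have hnn := (h0.add h1).nonneg fun n => by
    have hpos : 0 ≤ 1 / (n : ℝ) ^ 2 * (1 - Real.cos (2 * Real.pi * n * c)) :=
      mul_nonneg (by positivity) (by linarith [Real.cos_le_one (2 * Real.pi * n * c)])
    have := mul_nonneg hpos (hT.2.1 ((n : ℝ) • ξ))
    rw [cosPoly, Finsupp.sum, mul_add, Finset.mul_sum] at this
    rw [mul_comm a₀]
    refine this.trans_eq (congrArg _ (Finset.sum_congr rfl fun h _ => ?_))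
    rw [latticeDot_smul_right, ← mul_assoc (2 * Real.pi)]
    ring
  rw [← Finset.sum_mul] at hnn
  rw [Finsupp.sum] at hA
  rw [show ∑ h ∈ a.support, a h = 1 - a₀ by linarith] at hnn
  have hpi : 0 < Real.pi ^ 2 * c := by positivity
  -- After division by `π² c`, the inequality `a₀ (c - c²) - (1 - a₀) c² ≥ 0` reads `a₀ ≥ c`.
  nlinarith [hnn]

theorem gammaSup_le_deltaInf {k : ℕ} {H : Set (Fin k → ℤ)} (hH : (0 : Fin k → ℤ) ∉ H)
    (hne : H.Nonempty) : gammaSup H ≤ deltaInf H := by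
  refine iSup_le fun ξ => le_sInf ?_
  rintro _ ⟨a₀, a, hT, rfl⟩
  by_contra! hlt
  obtain ⟨c, hc1, hc2⟩ := EReal.lt_iff_exists_real_btwn.1 hlt
  rw [EReal.coe_lt_coe_iff] at hc1
  have h0 := hT.constant_nonneg hH
  have hc : ∀ h ∈ H, c ≤ distInt (latticeDot h ξ) := fun h hh =>
    EReal.coe_le_coe_iff.1 (hc2.le.trans (iInf₂_le h hh))
  obtain ⟨h, hh⟩ := hne
  exact hc1.not_ge (hT.le_constant (h0.trans_lt hc1) ((hc h hh).trans (distInt_le_half _)) hc)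

theorem gammaSup_nonneg {k : ℕ} (H : Set (Fin k → ℤ)) : 0 ≤ gammaSup H :=
  le_iSup_of_le 0 (le_iInf₂ fun _ _ => EReal.coe_nonneg.2 (distInt_nonneg _))

theorem isHeilbronn_iff_gammaSup_eq_zero {k : ℕ} (H : Set (Fin k → ℤ)) :
    IsHeilbronn H ↔ gammaSup H = 0 := by
  constructor
  · intro hH
    refine le_antisymm (iSup_le fun ξ => ?_) (gammaSup_nonneg H)
    by_contra! hlt
    obtain ⟨c, hc1, hc2⟩ := EReal.lt_iff_exists_real_btwn.1 hlt
    obtain ⟨h, hh, hlt⟩ := hH ξ c (by exact_mod_cast hc1)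
    exact (EReal.coe_lt_coe_iff.2 hlt).not_ge (hc2.le.trans (iInf₂_le h hh))
  · intro h0 ξ ε hε
    have h1 : ⨅ h ∈ H, ((distInt (latticeDot h ξ) : ℝ) : EReal) < ε :=
      ((le_iSup (fun ξ : Fin k → ℝ => ⨅ h ∈ H, ((distInt (latticeDot h ξ) : ℝ) : EReal)) ξ).trans
        h0.le).trans_lt (by exact_mod_cast hε)
    obtain ⟨h, h2⟩ := iInf_lt_iff.1 h1
    obtain ⟨hh, h3⟩ := iInf_lt_iff.1 h2
    exact ⟨h, hh, by exact_mod_cast h3⟩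

/-- `δ(H) = 0` means that the constant terms get arbitrarily small. -/
theorem deltaInf_eq_zero_iff {k : ℕ} {H : Set (Fin k → ℤ)} (hH : (0 : Fin k → ℤ) ∉ H) :
    deltaInf H = 0 ↔ ∀ ε : ℝ, 0 < ε → ∃ a₀ a, IsAdmissible H a₀ a ∧ a₀ < ε := by
  constructor
  · intro h0 ε hε
    have : deltaInf H < (ε : EReal) := by rw [h0]; exact_mod_cast hε
    obtain ⟨_, ⟨a₀, a, hT, rfl⟩, hlt⟩ := sInf_lt_iff.1 this
    exact ⟨a₀, a, hT, by exact_mod_cast hlt⟩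
  · intro h
    refine le_antisymm ?_ (le_sInf ?_)
    · by_contra! hlt
      obtain ⟨c, hc1, hc2⟩ := EReal.lt_iff_exists_real_btwn.1 hlt
      obtain ⟨a₀, a, hT, hlt⟩ := h c (by exact_mod_cast hc1)
      exact (EReal.coe_lt_coe_iff.2 hlt).not_ge (hc2.le.trans (sInf_le ⟨a₀, a, hT, rfl⟩))
    · rintro _ ⟨a₀, a, hT, rfl⟩
      exact EReal.coe_nonneg.2 (hT.constant_nonneg hH)

end Gamma

/-! ### Greedy choice of points -/

section Greedy

variable {k : ℕ}

lemma cosPoly_sum_single {ι : Type*} (s : Finset ι) (h : ι → Fin k → ℤ) (c : ι → ℝ) (a₀ : ℝ)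
    (x : Fin k → ℝ) : cosPoly a₀ (∑ i ∈ s, Finsupp.single (h i) (c i)) x =
      a₀ + ∑ i ∈ s, c i * Real.cos (2 * Real.pi * latticeDot (h i) x) := by
  rw [cosPoly, ← Finsupp.sum_finsetSum_index (fun _ => zero_mul _) fun _ _ _ => add_mul _ _ _]
  congr 1
  exact Finset.sum_congr rfl fun i _ => by rw [Finsupp.sum_single_index (zero_mul _)]

/-- If all constant terms are at least `δ`, no finite combination of the functions
`p + q e(h · x)`, `h ∈ H`, with `p < δ (p + q)`, has positive real part everywhere. -/
lemma exists_re_sum_nonpos {H : Set (Fin k → ℤ)} {δ : ℝ}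
    (hδ : ∀ a₀ a, IsAdmissible H a₀ a → δ ≤ a₀) {ι : Type*} (s : Finset ι) (h : ι → Fin k → ℤ)
    (hh : ∀ i, h i ∈ H) (z : ι → ℂ) {p q : ℝ} (hp : 0 ≤ p) (hq : 0 < q) (hpq : p < δ * (p + q)) :
    ∃ x : Fin k → ℝ, ∑ i ∈ s, ((starRingEnd ℂ) (z i) * (p + q * expDot (h i) x)).re ≤ 0 := by
  obtain ⟨x, hx⟩ : ∃ x : Fin k → ℝ, ∑ i ∈ s, (z i).re *
      (p + q * Real.cos (2 * Real.pi * latticeDot (h i) x)) ≤ 0 := by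
    by_contra! hpos
    have h0 := hpos 0
    simp only [latticeDot_zero_right, mul_zero, Real.cos_zero, mul_one, ← Finset.sum_mul] at h0
    set A := ∑ i ∈ s, (z i).re with hA
    have hA0 : 0 < A := pos_of_mul_pos_left h0 (by linarith)
    have hval : ∀ x, cosPoly (p / (p + q))
        (∑ i ∈ s, Finsupp.single (h i) (q * (z i).re / (A * (p + q)))) x =
        (∑ i ∈ s, (z i).re * (p + q * Real.cos (2 * Real.pi * latticeDot (h i) x))) /
          (A * (p + q)) := by
      intro x
      have hp' : p / (p + q) = ∑ i ∈ s, (z i).re * p / (A * (p + q)) := by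
        rw [← Finset.sum_div, ← Finset.sum_mul, ← hA]
        field_simp
      rw [cosPoly_sum_single, hp', ← Finset.sum_add_distrib, Finset.sum_div]
      exact Finset.sum_congr rfl fun i _ => by ring
    have hadm : IsAdmissible H (p / (p + q))
        (∑ i ∈ s, Finsupp.single (h i) (q * (z i).re / (A * (p + q)))) := by
      refine ⟨fun g hg => ?_, fun x => ?_, ?_⟩
      · obtain ⟨i, _, hi⟩ := Finset.mem_biUnion.1 (Finsupp.support_finsetSum hg)
        rw [Finset.mem_singleton.1 (Finsupp.support_single_subset hi)]
        exact hh i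
      · rw [hval]
        exact div_nonneg (hpos x).le h0.le
      · rw [hval]
        simp only [latticeDot_zero_right, mul_zero, Real.cos_zero, mul_one, ← Finset.sum_mul]
        exact div_self h0.ne'
    have := hδ _ _ hadm
    rw [le_div_iff₀ (by linarith)] at this
    linarith
  have hre : ∀ x : Fin k → ℝ, ∑ i ∈ s, ((starRingEnd ℂ) (z i) * (p + q * expDot (h i) x)).re =
      ∑ i ∈ s, (z i).re * (p + q * Real.cos (2 * Real.pi * latticeDot (h i) x)) +
        ∑ i ∈ s, (z i).im * q * Real.sin (2 * Real.pi * latticeDot (h i) x) := by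
    intro x
    rw [← Finset.sum_add_distrib]
    refine Finset.sum_congr rfl fun i _ => ?_
    simp [Complex.mul_re, re_expDot, im_expDot]
    ring
  -- The sine part is odd and the cosine part even, so one of `x` and `-x` works.
  rcases le_total (∑ i ∈ s, (z i).im * q * Real.sin (2 * Real.pi * latticeDot (h i) x)) 0
    with hs | hs
  · exact ⟨x, by rw [hre]; linarith⟩
  · refine ⟨-x, ?_⟩
    rw [hre]
    simp only [latticeDot_neg_right, mul_neg, Real.cos_neg, Real.sin_neg, Finset.sum_neg_distrib]
    linarith

lemma sq_succ_le_four_mul_two_pow (t : ℕ) : ((t : ℝ) + 1) ^ 2 ≤ 4 * 2 ^ t := by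
  have : ∀ t : ℕ, (t + 1) ^ 2 ≤ 4 * 2 ^ t := by
    intro t
    induction t with
    | zero => norm_num
    | succ t ih =>
      rcases Nat.lt_or_ge t 2 with h | h
      · interval_cases t <;> norm_num
      · rw [pow_succ 2 t]; nlinarith
  exact_mod_cast this t

/-- Vectors chosen so that each has nonpositive correlation with the preceding partial sum have
small partial sums, in each coordinate. -/
lemma norm_sq_partialSum_le {w : ℕ → ℕ → ℂ} (hw : ∀ t i, ‖w t i‖ ≤ 2 * t + 1)
    (hgreedy : ∀ t, ∑ i ∈ Finset.range t, ((starRingEnd ℂ) (((1 / 2 : ℝ) ^ i : ℝ) *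
      ∑ j ∈ Finset.range t, w j i) * w t i).re ≤ 0) {i t : ℕ} (hit : i < t) :
    ‖∑ j ∈ Finset.range t, w j i‖ ^ 2 ≤ 2 ^ i * (12 * t ^ 3) := by
  set S : ℕ → ℕ → ℂ := fun t i => ∑ j ∈ Finset.range t, w j i with hS
  have hSt : ∀ t i, ‖S t i‖ ≤ (t : ℝ) ^ 2 := by
    intro t i
    induction t with
    | zero => simp [hS]
    | succ t ih =>
      have : S (t + 1) i = S t i + w t i := Finset.sum_range_succ _ _
      rw [this]
      refine (norm_add_le _ _).trans ((add_le_add ih (hw t i)).trans_eq ?_)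
      push_cast; ring
  have hΦ : ∀ t : ℕ, ∑ i ∈ Finset.range t, (1 / 2 : ℝ) ^ i * ‖S t i‖ ^ 2 ≤ 12 * (t : ℝ) ^ 3 := by
    intro t
    induction t with
    | zero => simp
    | succ t ih =>
      have hstep : ∀ i, (1 / 2 : ℝ) ^ i * ‖S (t + 1) i‖ ^ 2 ≤ (1 / 2 : ℝ) ^ i * ‖S t i‖ ^ 2 +
          2 * ((starRingEnd ℂ) (((1 / 2 : ℝ) ^ i : ℝ) * S t i) * w t i).re +
            (1 / 2 : ℝ) ^ i * (2 * t + 1) ^ 2 := by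
        intro i
        have h1 : S (t + 1) i = w t i + S t i := by
          rw [add_comm (w t i)]; exact Finset.sum_range_succ (fun j => w j i) t
        have h2 : ((starRingEnd ℂ) (((1 / 2 : ℝ) ^ i : ℝ) * S t i) * w t i).re =
            (1 / 2 : ℝ) ^ i * (w t i * (starRingEnd ℂ) (S t i)).re := by
          rw [map_mul, Complex.conj_ofReal, mul_assoc, Complex.re_ofReal_mul, mul_comm (w t i)]
        rw [h1, ← Complex.normSq_eq_norm_sq, Complex.normSq_add, Complex.normSq_eq_norm_sq,
          Complex.normSq_eq_norm_sq, h2]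
        have h3 : ‖w t i‖ ^ 2 ≤ (2 * (t : ℝ) + 1) ^ 2 :=
          pow_le_pow_left₀ (norm_nonneg _) (hw t i) 2
        have h4 := mul_le_mul_of_nonneg_left h3 (by positivity : (0 : ℝ) ≤ (1 / 2 : ℝ) ^ i)
        linarith
      have hsum := Finset.sum_le_sum fun i (_ : i ∈ Finset.range t) => hstep i
      rw [Finset.sum_add_distrib, Finset.sum_add_distrib, ← Finset.mul_sum, ← Finset.sum_mul]
        at hsum
      have hgeom : ∑ i ∈ Finset.range t, (1 / 2 : ℝ) ^ i ≤ 2 := sum_geometric_two_le t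
      -- Coordinate `t` enters the weighted sum only now, uncontrolled so far; the trivial bound `(t
      -- + 1) ^ 4` is absorbed by the weight `2⁻ᵗ`.
      have hlast : (1 / 2 : ℝ) ^ t * ‖S (t + 1) t‖ ^ 2 ≤ 4 * ((t : ℝ) + 1) ^ 2 := by
        have h1 := pow_le_pow_left₀ (norm_nonneg _) (hSt (t + 1) t) 2
        push_cast at h1
        rw [one_div, inv_pow, inv_mul_le_iff₀ (by positivity)]
        have h2 := sq_succ_le_four_mul_two_pow t
        have h3 : (0 : ℝ) ≤ ((t : ℝ) + 1) ^ 2 := by positivity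
        nlinarith
      rw [Finset.sum_range_succ]
      have hg := hgreedy t
      have h5 := mul_le_mul_of_nonneg_right hgeom (by positivity : (0 : ℝ) ≤ (2 * (t : ℝ) + 1) ^ 2)
      have ht : (0 : ℝ) ≤ t := t.cast_nonneg
      push_cast
      -- The increment is at most `2 (2t + 1)² + 4 (t + 1)²`, which is below `12 ((t + 1)³ - t³)`.
      nlinarith [pow_nonneg ht 2, pow_nonneg ht 3]
  have h1 : (1 / 2 : ℝ) ^ i * ‖S t i‖ ^ 2 ≤ 12 * (t : ℝ) ^ 3 :=
    (Finset.single_le_sum (f := fun i => (1 / 2 : ℝ) ^ i * ‖S t i‖ ^ 2)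
      (fun j _ => by positivity) (Finset.mem_range.2 hit)).trans (hΦ t)
  rwa [one_div, inv_pow, inv_mul_le_iff₀ (by positivity)] at h1

/-- The squared sums are `O(t³)` for fixed `i`, against `t⁴`. -/
lemma tendsto_norm_partialSum_div {w : ℕ → ℕ → ℂ} (hw : ∀ t i, ‖w t i‖ ≤ 2 * t + 1)
    (hgreedy : ∀ t, ∑ i ∈ Finset.range t, ((starRingEnd ℂ) (((1 / 2 : ℝ) ^ i : ℝ) *
      ∑ j ∈ Finset.range t, w j i) * w t i).re ≤ 0) (i : ℕ) :
    Tendsto (fun t : ℕ => ‖∑ j ∈ Finset.range t, w j i‖ / (t : ℝ) ^ 2) atTop (𝓝 0) := by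
  have h1 : Tendsto (fun t : ℕ => Real.sqrt (2 ^ i * 12 * (t : ℝ)⁻¹)) atTop (𝓝 0) := by
    have := ((tendsto_inv_atTop_nhds_zero_nat (𝕜 := ℝ)).const_mul (2 ^ i * 12)).sqrt
    simpa using this
  refine tendsto_of_tendsto_of_tendsto_of_le_of_le' tendsto_const_nhds h1
    (Eventually.of_forall fun t => by positivity) ?_
  filter_upwards [eventually_gt_atTop i] with t ht
  have ht0 : (0 : ℝ) < t := by exact_mod_cast (Nat.zero_le i).trans_lt ht
  refine Real.le_sqrt_of_sq_le ?_
  rw [div_pow, div_le_iff₀ (by positivity)]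
  refine (norm_sq_partialSum_le hw hgreedy ht).trans_eq ?_
  field_simp

/-- Points chosen greedily so that the weighted exponential sums at a sequence of frequencies of
`H` are small. -/
lemma exists_points {H : Set (Fin k → ℤ)} {δ : ℝ} (hδ : ∀ a₀ a, IsAdmissible H a₀ a → δ ≤ a₀)
    {e : ℕ → Fin k → ℤ} (he : ∀ i, e i ∈ H) {p : ℕ} (hp : 0 < p) (hpδ : 1 < δ * (2 * p)) :
    ∃ y : ℕ → Fin k → ℝ, ∀ i, Tendsto (fun t : ℕ => ‖∑ j ∈ Finset.range t,
      (((j / p : ℕ) : ℂ) + ((2 * j + 1 - j / p : ℕ) : ℂ) * expDot (e i) (y j))‖ / (t : ℝ) ^ 2)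
        atTop (𝓝 0) := by
  have hpick : ∀ (t : ℕ) (S : ℕ → ℂ), ∃ x : Fin k → ℝ, ∑ i ∈ Finset.range t,
      ((starRingEnd ℂ) (((1 / 2 : ℝ) ^ i : ℝ) * S i) * (((t / p : ℕ) : ℂ) +
        ((2 * t + 1 - t / p : ℕ) : ℂ) * expDot (e i) x)).re ≤ 0 := by
    intro t S
    have hle : t / p ≤ t := Nat.div_le_self _ _
    have hle2 : ((t / p : ℕ) : ℝ) * p ≤ t := by exact_mod_cast Nat.div_mul_le_self t p
    have hp0 : (0 : ℝ) < p := by exact_mod_cast hp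
    have hcast : ((2 * t + 1 - t / p : ℕ) : ℝ) = 2 * t + 1 - (t / p : ℕ) := by
      rw [Nat.cast_sub (by omega)]; push_cast; ring
    have := exists_re_sum_nonpos hδ (Finset.range t) e he
      (fun i => (((1 / 2 : ℝ) ^ i : ℝ) : ℂ) * S i)
      (p := ((t / p : ℕ) : ℝ)) (q := ((2 * t + 1 - t / p : ℕ) : ℝ)) (by positivity)
      (by exact_mod_cast (by omega : 0 < 2 * t + 1 - t / p)) (by
        -- The weights add up to `2t + 1`, and `t / p < δ (2t + 1)` because `1 < 2 p δ`.
        rw [hcast, add_sub_cancel]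
        have h1 : (2 * (t : ℝ) + 1) < δ * (2 * p) * (2 * t + 1) := by
          have : (0 : ℝ) < 2 * t + 1 := by positivity
          nlinarith
        have h2 : ((t / p : ℕ) : ℝ) * (2 * p) < δ * (2 * t + 1) * (2 * p) := by nlinarith
        exact lt_of_mul_lt_mul_right h2 (by positivity))
    exact_mod_cast this
  choose pick hpick using hpick
  let W : ℕ → (Fin k → ℝ) → ℕ → ℂ := fun t x i =>
    ((t / p : ℕ) : ℂ) + ((2 * t + 1 - t / p : ℕ) : ℂ) * expDot (e i) x
  -- Each point depends on the sums produced by all earlier ones, so the recursion carries the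
  -- vector of sums.
  let S : ℕ → ℕ → ℂ := fun t => Nat.rec (fun _ => 0) (fun t St i => St i + W t (pick t St) i) t
  have hS : ∀ t i, S t i = ∑ j ∈ Finset.range t, W j (pick j (S j)) i := by
    intro t i
    induction t with
    | zero => rfl
    | succ t ih => rw [Finset.sum_range_succ, ← ih]
  refine ⟨fun t => pick t (S t), tendsto_norm_partialSum_div (w := fun t i => W t (pick t (S t)) i)
    (fun t i => ?_) fun t => ?_⟩
  · refine (norm_add_le _ _).trans ?_
    rw [norm_mul, norm_expDot, mul_one, Complex.norm_natCast, Complex.norm_natCast]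
    have hle : t / p ≤ t := Nat.div_le_self _ _
    exact_mod_cast (by omega : t / p + (2 * t + 1 - t / p) ≤ 2 * t + 1)
  · have := hpick t (S t)
    simp only [hS] at this ⊢
    exact this

end Greedy

/-! ### Square blocks and their labels -/

section Blocks

/-- The label of an integer: the square block `[t², (t+1)²)` in which it lies, and whether it lies
in the initial part of length `t / p` of this block. -/
def blockLabel (p : ℕ) (m : ℤ) : ℕ × Bool :=
  (Nat.sqrt m.toNat, decide (p * (m.toNat - Nat.sqrt m.toNat ^ 2 + 1) ≤ Nat.sqrt m.toNat))

lemma blockLabel_natCast (p t r : ℕ) (hr : r < 2 * t + 1) :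
    blockLabel p ((t ^ 2 + r : ℕ) : ℤ) = (t, decide (p * (r + 1) ≤ t)) := by
  have h : Nat.sqrt (t ^ 2 + r) = t := by
    rw [pow_two]; exact Nat.sqrt_add_eq t (by omega)
  rw [blockLabel, Int.toNat_natCast, h, Nat.add_sub_cancel_left]

lemma sum_Ico_zero_natCast {M : Type*} [AddCommMonoid M] (g : ℤ → M) (n : ℕ) :
    ∑ m ∈ Finset.Ico (0 : ℤ) n, g m = ∑ m ∈ Finset.range n, g (m : ℤ) := by
  refine (Finset.sum_nbij' (fun m : ℕ => (m : ℤ)) Int.toNat ?_ ?_ ?_ ?_ ?_).symm <;>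
    simp +contextual

lemma sum_range_sq_succ {M : Type*} [AddCommMonoid M] (f : ℕ → M) (t : ℕ) :
    ∑ m ∈ Finset.range ((t + 1) ^ 2), f m =
      ∑ m ∈ Finset.range (t ^ 2), f m + ∑ r ∈ Finset.range (2 * t + 1), f (t ^ 2 + r) := by
  rw [show (t + 1) ^ 2 = t ^ 2 + (2 * t + 1) by ring, Finset.sum_range_add]

lemma sum_block_blockLabel {p : ℕ} (hp : 0 < p) (F : ℕ × Bool → ℂ) (t : ℕ) :
    ∑ r ∈ Finset.range (2 * t + 1), F (blockLabel p ((t ^ 2 + r : ℕ) : ℤ)) =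
      ((t / p : ℕ) : ℂ) * F (t, true) + ((2 * t + 1 - t / p : ℕ) : ℂ) * F (t, false) := by
  have hle : t / p ≤ t := Nat.div_le_self _ _
  have hiff : ∀ r, p * (r + 1) ≤ t ↔ r < t / p := fun r => by
    rw [mul_comm, ← Nat.le_div_iff_mul_le hp, Nat.succ_le_iff]
  obtain ⟨d, hd⟩ : ∃ d, 2 * t + 1 = t / p + d := ⟨2 * t + 1 - t / p, by omega⟩
  have h1 : ∀ r ∈ Finset.range (2 * t + 1), F (blockLabel p ((t ^ 2 + r : ℕ) : ℤ)) =
      F (t, decide (r < t / p)) := fun r hr => by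
    rw [blockLabel_natCast _ _ _ (Finset.mem_range.1 hr)]
    simp only [hiff]
  rw [Finset.sum_congr rfl h1, hd, Finset.sum_range_add, Nat.add_sub_cancel_left]
  congr 1
  · rw [Finset.sum_congr rfl fun r hr => by rw [decide_eq_true (Finset.mem_range.1 hr)]]
    simp
  · rw [Finset.sum_congr rfl fun r _ => by rw [decide_eq_false (by omega)]]
    simp

lemma sum_blockLabel {p : ℕ} (hp : 0 < p) (F : ℕ × Bool → ℂ) (t : ℕ) :
    ∑ m ∈ Finset.Ico (0 : ℤ) (t ^ 2 : ℕ), F (blockLabel p m) = ∑ j ∈ Finset.range t,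
      (((j / p : ℕ) : ℂ) * F (j, true) + ((2 * j + 1 - j / p : ℕ) : ℂ) * F (j, false)) := by
  rw [sum_Ico_zero_natCast]
  induction t with
  | zero => simp
  | succ t ih => rw [sum_range_sq_succ, ih, sum_block_blockLabel hp, ← Finset.sum_range_succ]

/-- Indicator of the integers whose label changes under translation by `a`. -/
def labelChange (p : ℕ) (a m : ℤ) : ℝ :=
  if blockLabel p (m + a) = blockLabel p m then 0 else 1

lemma labelChange_nonneg (p : ℕ) (a m : ℤ) : 0 ≤ labelChange p a m := by
  unfold labelChange; split_ifs <;> norm_num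

lemma labelChange_le_one (p : ℕ) (a m : ℤ) : labelChange p a m ≤ 1 := by
  unfold labelChange; split_ifs <;> norm_num

lemma labelChange_one_eq_zero {p t r : ℕ} (hp : 0 < p) (hr : r < 2 * t) (hr2 : r + 1 ≠ t / p) :
    labelChange p 1 ((t ^ 2 + r : ℕ) : ℤ) = 0 := by
  rw [labelChange, if_pos]
  have hiff : ∀ r, p * (r + 1) ≤ t ↔ r < t / p := fun r => by
    rw [mul_comm, ← Nat.le_div_iff_mul_le hp, Nat.succ_le_iff]
  have h1 : ((t ^ 2 + r : ℕ) : ℤ) + 1 = ((t ^ 2 + (r + 1) : ℕ) : ℤ) := by push_cast; ring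
  rw [h1, blockLabel_natCast _ _ _ (by omega), blockLabel_natCast _ _ _ (by omega)]
  simp only [hiff, Prod.mk.injEq, true_and, decide_eq_decide]
  omega

lemma sum_labelChange_one_le {p : ℕ} (hp : 0 < p) (t : ℕ) :
    ∑ m ∈ Finset.Ico (0 : ℤ) (t ^ 2 : ℕ), labelChange p 1 m ≤ 2 * t := by
  rw [sum_Ico_zero_natCast]
  induction t with
  | zero => simp
  | succ t ih =>
    rw [sum_range_sq_succ]
    -- Only the end of the block and the end of its initial part can change the label. If `t / p =
    -- 0`, truncated subtraction charges `r = 0` needlessly, which is harmless.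
    have h1 : ∑ r ∈ Finset.range (2 * t + 1), labelChange p 1 ((t ^ 2 + r : ℕ) : ℤ) ≤
        ∑ r ∈ Finset.range (2 * t + 1),
          ((if r = 2 * t then (1 : ℝ) else 0) + if r = t / p - 1 then 1 else 0) := by
      refine Finset.sum_le_sum fun r hr => ?_
      rw [Finset.mem_range] at hr
      by_cases h : r < 2 * t ∧ r + 1 ≠ t / p
      · rw [labelChange_one_eq_zero hp h.1 h.2]
        positivity
      · refine (labelChange_le_one _ _ _).trans ?_
        by_cases h2 : r = 2 * t
        · rw [if_pos h2]
          exact le_add_of_nonneg_right (by positivity)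
        · rw [if_pos (by omega : r = t / p - 1)]
          exact le_add_of_nonneg_left (by positivity)
    have h2 : ∑ r ∈ Finset.range (2 * t + 1),
        ((if r = 2 * t then (1 : ℝ) else 0) + if r = t / p - 1 then 1 else 0) ≤ 2 := by
      rw [Finset.sum_add_distrib, Finset.sum_ite_eq', Finset.sum_ite_eq']
      split_ifs <;> norm_num
    rw [Nat.cast_succ]
    linarith

end Blocks

/-! ### Averages depending on one coordinate -/

section CoordinateAverages

variable {k : ℕ}

lemma tendsto_natSqrt_atTop : Tendsto Nat.sqrt atTop atTop :=
  tendsto_atTop_atTop.2 fun b => ⟨b * b, fun _ h => Nat.le_sqrt.2 h⟩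

/-- Averages of a bounded function of one coordinate are controlled by its sums up to squares. -/
lemma tendsto_boxAverage_coord (i₀ : Fin k) {g : ℤ → ℂ} (hg : ∀ m, ‖g m‖ ≤ 1)
    (h : Tendsto (fun t : ℕ => ‖∑ m ∈ Finset.Ico (0 : ℤ) (t ^ 2 : ℕ), g m‖ / (t : ℝ) ^ 2)
      atTop (𝓝 0)) :
    Tendsto (boxAverage fun n : Fin k → ℤ => g (n i₀)) atTop (𝓝 0) := by
  have h1 : Tendsto (fun t : ℕ => ‖∑ m ∈ Finset.Ico (0 : ℤ) (t ^ 2 : ℕ), g m‖ / (t : ℝ) ^ 2 +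
      2 * (t : ℝ)⁻¹) atTop (𝓝 0) := by
    simpa using h.add ((tendsto_inv_atTop_nhds_zero_nat (𝕜 := ℝ)).const_mul 2)
  refine squeeze_zero_norm' ?_
    ((h1.comp tendsto_natSqrt_atTop).comp (tendsto_eval_atTop_atTop i₀))
  filter_upwards [eventually_forall_pos] with N hN
  rw [boxAverage_eq, average_box_coord i₀ g hN, norm_mul, norm_inv, Complex.norm_natCast]
  simp only [Function.comp_apply]
  set M := N i₀
  have hM : 0 < M := hN i₀
  set t := Nat.sqrt M with ht
  have ht0 : 0 < t := Nat.sqrt_pos.2 hM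
  have htM : t ^ 2 ≤ M := Nat.sqrt_le' M
  have hMt : M ≤ t ^ 2 + 2 * t := by
    have := Nat.sqrt_le_add M
    rw [pow_two, ht]; omega
  have hsum : ‖∑ m ∈ Finset.Ico (0 : ℤ) M, g m‖ ≤
      ‖∑ m ∈ Finset.Ico (0 : ℤ) (t ^ 2 : ℕ), g m‖ + 2 * t := by
    obtain ⟨d, hd⟩ := Nat.exists_eq_add_of_le htM
    rw [sum_Ico_zero_natCast, sum_Ico_zero_natCast, hd, Finset.sum_range_add]
    refine (norm_add_le _ _).trans (add_le_add_right ?_ _)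
    refine (norm_sum_le _ _).trans ((Finset.sum_le_sum fun m _ => hg _).trans ?_)
    rw [Finset.sum_const, Finset.card_range, nsmul_eq_mul, mul_one]
    exact_mod_cast (by omega : d ≤ 2 * t)
  have ht0' : (0 : ℝ) < t := by exact_mod_cast ht0
  have htM' : (t : ℝ) ^ 2 ≤ M := by exact_mod_cast htM
  calc (M : ℝ)⁻¹ * ‖∑ m ∈ Finset.Ico (0 : ℤ) M, g m‖
      ≤ ((t : ℝ) ^ 2)⁻¹ * (‖∑ m ∈ Finset.Ico (0 : ℤ) (t ^ 2 : ℕ), g m‖ + 2 * t) := by gcongr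
    _ = _ := by field_simp

lemma tendsto_boxAverage_of_norm_le {v : (Fin k → ℤ) → ℂ} {f : (Fin k → ℤ) → ℝ}
    (hv : ∀ n, ‖v n‖ ≤ f n) (hf : Tendsto (boxAverage fun n => (f n : ℂ)) atTop (𝓝 0)) :
    Tendsto (boxAverage v) atTop (𝓝 0) := by
  refine squeeze_zero_norm (fun N => (norm_boxAverage_le hv N).trans ?_)
    (tendsto_zero_iff_norm_tendsto_zero.1 hf)
  rw [boxAverage_eq, norm_mul, norm_inv, Complex.norm_natCast, ← Complex.ofReal_sum,
    Complex.norm_real]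
  gcongr
  exact le_abs_self _

lemma tendsto_boxAverage_shift {w : (Fin k → ℤ) → ℂ} {C : ℝ} (hw : ∀ n, ‖w n‖ ≤ C)
    (h0 : Tendsto (boxAverage w) atTop (𝓝 0)) (h : Fin k → ℤ) :
    Tendsto (boxAverage fun n => w (n + h)) atTop (𝓝 0) := by
  have h1 : Tendsto (fun N => boxAverage (fun n => w (n + h)) N - boxAverage w N) atTop (𝓝 0) := by
    refine squeeze_zero_norm (norm_boxAverage_shift_sub_le h hw) ?_
    simpa using ((tendsto_escape h).const_mul C).add ((tendsto_escape (-h)).const_mul C)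
  simpa using h1.add h0

lemma tendsto_boxAverage_labelChange {p : ℕ} (hp : 0 < p) (i₀ : Fin k) (a : ℤ) :
    Tendsto (boxAverage fun n : Fin k → ℤ => (labelChange p a (n i₀) : ℂ)) atTop (𝓝 0) := by
  have hnorm : ∀ a m, ‖(labelChange p a m : ℂ)‖ ≤ 1 := fun a m => by
    rw [Complex.norm_real, Real.norm_of_nonneg (labelChange_nonneg _ _ _)]
    exact labelChange_le_one _ _ _
  have hone : ∀ b : ℤ, Tendsto (boxAverage fun n : Fin k → ℤ =>
      (labelChange p 1 (n i₀ + b) : ℂ)) atTop (𝓝 0) := by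
    intro b
    have h1 : Tendsto (boxAverage fun n : Fin k → ℤ => (labelChange p 1 (n i₀) : ℂ))
        atTop (𝓝 0) := by
      refine tendsto_boxAverage_coord i₀ (g := fun m => (labelChange p 1 m : ℂ)) (hnorm 1) ?_
      have h2 : Tendsto (fun t : ℕ => 2 * (t : ℝ)⁻¹) atTop (𝓝 0) := by
        simpa using (tendsto_inv_atTop_nhds_zero_nat (𝕜 := ℝ)).const_mul 2
      refine squeeze_zero (fun t => by positivity) (fun t => ?_) h2
      rw [← Complex.ofReal_sum, Complex.norm_real,
        Real.norm_of_nonneg (Finset.sum_nonneg fun m _ => labelChange_nonneg _ _ _)]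
      rcases Nat.eq_zero_or_pos t with rfl | ht
      · simp
      · have ht' : (0 : ℝ) < t := by exact_mod_cast ht
        rw [div_le_iff₀ (by positivity)]
        refine (sum_labelChange_one_le hp t).trans_eq ?_
        field_simp
    have := tendsto_boxAverage_shift (fun n => hnorm 1 (n i₀)) h1 (fun _ => b)
    exact this
  -- A change of label over a longer shift forces one over the shorter shift or over the remaining
  -- unit step; this drives the induction on `a` in both directions.
  have hstep : ∀ (b c : ℤ), (c = b + 1 ∨ b = c + 1) → ∀ m,
      labelChange p c m ≤ labelChange p b m + labelChange p 1 (m + min b c) := by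
    intro b c hbc m
    unfold labelChange
    rcases hbc with rfl | rfl
    · rw [min_eq_left (by omega), add_assoc]
      split_ifs <;> simp_all
    · rw [min_eq_right (by omega), add_assoc]
      split_ifs <;> simp_all
  have hind : ∀ b c : ℤ, (c = b + 1 ∨ b = c + 1) →
      Tendsto (boxAverage fun n : Fin k → ℤ => (labelChange p b (n i₀) : ℂ)) atTop (𝓝 0) →
      Tendsto (boxAverage fun n : Fin k → ℤ => (labelChange p c (n i₀) : ℂ)) atTop (𝓝 0) := by
    intro b c hbc hb
    refine tendsto_boxAverage_of_norm_le
      (f := fun n => labelChange p b (n i₀) + labelChange p 1 (n i₀ + min b c)) (fun n => ?_) ?_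
    · rw [Complex.norm_real, Real.norm_of_nonneg (labelChange_nonneg _ _ _)]
      exact hstep b c hbc _
    · have h1 := hb.add (hone (min b c))
      rw [add_zero] at h1
      refine h1.congr fun N => ?_
      rw [← boxAverage_add]
      simp
  induction a using Int.induction_on with
  | zero =>
    refine tendsto_const_nhds.congr fun N => ?_
    simp [labelChange, boxAverage]
  | succ n ih => exact hind _ _ (Or.inl rfl) ih
  | pred n ih => exact hind _ _ (Or.inr (by ring)) ih

end CoordinateAverages

/-! ### The van der Corput property implies small constant terms -/

section Necessity

variable {k : ℕ}

/-- The family equal to `s n ↦ e(n · y_t)` on the blocks, with value `1` on the initial parts of the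
blocks. -/
def blockFamily (p : ℕ) (i₀ : Fin k) (s : ℂ) (y : ℕ → Fin k → ℝ) (n : Fin k → ℤ) : ℂ :=
  bif (blockLabel p (n i₀)).2 then 1 else s * expDot n (y (blockLabel p (n i₀)).1)

lemma norm_blockFamily {p : ℕ} {i₀ : Fin k} {s : ℂ} (hs : ‖s‖ = 1) (y : ℕ → Fin k → ℝ)
    (n : Fin k → ℤ) : ‖blockFamily p i₀ s y n‖ = 1 := by
  unfold blockFamily
  cases (blockLabel p (n i₀)).2 <;> simp [norm_expDot, hs]

lemma tendsto_corr_blockFamily {p : ℕ} (hp : 0 < p) (i₀ : Fin k) {s : ℂ} (hs : ‖s‖ = 1)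
    {y : ℕ → Fin k → ℝ} {h : Fin k → ℤ}
    (hy : Tendsto (fun t : ℕ => ‖∑ j ∈ Finset.range t, (((j / p : ℕ) : ℂ) +
      ((2 * j + 1 - j / p : ℕ) : ℂ) * expDot h (y j))‖ / (t : ℝ) ^ 2) atTop (𝓝 0)) :
    Tendsto (boxAverage fun n => blockFamily p i₀ s y (n + h) *
      (starRingEnd ℂ) (blockFamily p i₀ s y n)) atTop (𝓝 0) := by
  set F : ℕ × Bool → ℂ := fun l => bif l.2 then 1 else expDot h (y l.1) with hF
  have hFnorm : ∀ l, ‖F l‖ = 1 := fun ⟨t, b⟩ => by cases b <;> simp [hF, norm_expDot]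
  have hmain : Tendsto (boxAverage fun n : Fin k → ℤ => F (blockLabel p (n i₀))) atTop (𝓝 0) := by
    refine tendsto_boxAverage_coord i₀ (g := fun m => F (blockLabel p m))
      (fun m => (hFnorm _).le) ?_
    refine hy.congr fun t => ?_
    rw [sum_blockLabel hp]
    simp [hF]
  have hdiff : Tendsto (boxAverage fun n : Fin k → ℤ => blockFamily p i₀ s y (n + h) *
      (starRingEnd ℂ) (blockFamily p i₀ s y n) - F (blockLabel p (n i₀))) atTop (𝓝 0) := by
    -- Where the label is unchanged the correlation equals `F` exactly, `s` cancelling; elsewhere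
    -- the trivial bound `2` applies on a set of density zero.
    refine tendsto_boxAverage_of_norm_le (f := fun n => 2 * labelChange p (h i₀) (n i₀))
      (fun n => ?_) ?_
    · by_cases hl : blockLabel p (n i₀ + h i₀) = blockLabel p (n i₀)
      · rw [labelChange, if_pos hl, mul_zero, norm_le_zero_iff, sub_eq_zero, blockFamily,
          blockFamily, Pi.add_apply, hl]
        simp only [hF]
        cases (blockLabel p (n i₀)).2
        · have hs2 : s * (starRingEnd ℂ) s = 1 := by
            rw [Complex.mul_conj, Complex.normSq_eq_norm_sq, hs]; norm_num
          simp only [cond_false, expDot_add, map_mul]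
          linear_combination expDot h (y (blockLabel p (n i₀)).1) *
            (expDot n (y (blockLabel p (n i₀)).1) *
              (starRingEnd ℂ) (expDot n (y (blockLabel p (n i₀)).1)) * hs2 +
                expDot_mul_conj n (y (blockLabel p (n i₀)).1))
        · simp
      · rw [labelChange, if_neg hl, mul_one]
        refine (norm_sub_le _ _).trans ?_
        rw [norm_mul, RCLike.norm_conj, norm_blockFamily hs, norm_blockFamily hs, hFnorm]
        norm_num
    · have := (tendsto_boxAverage_labelChange hp i₀ (h i₀)).const_mul 2
      rw [mul_zero] at this
      refine this.congr fun N => ?_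
      rw [← boxAverage_const_mul]
      push_cast
      rfl
  have := hdiff.add hmain
  rw [add_zero] at this
  refine this.congr fun N => ?_
  rw [boxAverage_sub, sub_add_cancel]

/-- The initial parts of the blocks have positive upper density. -/
lemma not_tendsto_boxAverage_initial {p : ℕ} (hp : 0 < p) (i₀ : Fin k) :
    ¬ Tendsto (boxAverage fun n : Fin k → ℤ =>
      bif (blockLabel p (n i₀)).2 then (1 : ℂ) else 0) atTop (𝓝 0) := by
  intro hlim
  -- Sides that are perfect squares contain only complete blocks.
  have hsub : Tendsto (fun (s : ℕ) (_ : Fin k) => (2 * p * (s + 1)) ^ 2) atTop atTop := by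
    refine tendsto_atTop.2 fun b => eventually_all.2 fun i => ?_
    filter_upwards [eventually_ge_atTop (b i)] with s hs
    nlinarith [Nat.mul_pos hp (Nat.succ_pos s)]
  have h1 := (hlim.comp hsub).norm
  rw [norm_zero] at h1
  have hp' : (0 : ℝ) < p := by exact_mod_cast hp
  refine (lt_irrefl (0 : ℝ)) ((by positivity : (0 : ℝ) < 1 / (4 * p)).trans_le
    (ge_of_tendsto' h1 fun s => ?_))
  set S := s + 1 with hS
  have hS' : (0 : ℝ) < S := by positivity
  have hN : ∀ i : Fin k, 0 < (fun _ : Fin k => (2 * p * S) ^ 2) i := fun _ => by positivity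
  rw [Function.comp_apply, boxAverage_eq, average_box_coord i₀
    (fun m => bif (blockLabel p m).2 then (1 : ℂ) else 0) hN,
    sum_blockLabel hp (fun l => bif l.2 then (1 : ℂ) else 0), norm_mul, norm_inv,
    Complex.norm_natCast]
  simp only [cond_true, cond_false, mul_one, mul_zero, add_zero]
  rw [← Nat.cast_sum, Complex.norm_natCast]
  -- The upper half of the range, `j ≥ p S`, contributes at least `S` per term; division by `(2 p
  -- S)²` leaves `1 / (4 p)`.
  have hsum : p * S * S ≤ ∑ j ∈ Finset.range (2 * p * S), j / p := by
    rw [show 2 * p * S = p * S + p * S by ring, Finset.sum_range_add]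
    refine le_add_left ?_
    calc p * S * S = ∑ _j ∈ Finset.range (p * S), S := by simp
      _ ≤ _ := Finset.sum_le_sum fun j _ => (Nat.le_div_iff_mul_le hp).2 (by nlinarith)
  have hsum' : (p : ℝ) * S * S ≤ ((∑ j ∈ Finset.range (2 * p * S), j / p : ℕ) : ℝ) := by
    exact_mod_cast hsum
  refine le_trans (le_of_eq ?_) (mul_le_mul_of_nonneg_left hsum' (by positivity))
  push_cast
  field_simp
  norm_num

/-- For empty `H` the correlation hypothesis is void, and the constant family `1` has average `1`.
-/
lemma IsVanDerCorput.nonempty {H : Set (Fin k → ℤ)} (hV : IsVanDerCorput H) : H.Nonempty := by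
  by_contra hne
  rw [Set.not_nonempty_iff_eq_empty] at hne
  have h1 := hV (fun _ => 1) (fun _ => norm_one) (by simp [hne])
  have h2 : Tendsto (boxAverage fun _ : Fin k → ℤ => (1 : ℂ)) atTop (𝓝 1) := by
    refine tendsto_const_nhds.congr' ?_
    filter_upwards [eventually_forall_pos] with N hN
    rw [boxAverage_const _ hN]
  exact one_ne_zero (tendsto_nhds_unique h2 h1)

theorem IsVanDerCorput.forall_exists_isAdmissible {H : Set (Fin k → ℤ)} (hV : IsVanDerCorput H)
    (h0 : (0 : Fin k → ℤ) ∉ H) (ε : ℝ) (hε : 0 < ε) : ∃ a₀ a, IsAdmissible H a₀ a ∧ a₀ < ε := by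
  by_contra! hδ
  have hne := hV.nonempty
  obtain ⟨g, hg⟩ := hne
  -- A nonzero frequency forces `k` to be positive; any coordinate can carry the blocks.
  obtain ⟨i₀, -⟩ := Function.ne_iff.1 (fun hg0 => h0 (hg0 ▸ hg) : g ≠ 0)
  obtain ⟨e, he⟩ := (Set.to_countable H).exists_eq_range ⟨g, hg⟩
  obtain ⟨p, hp⟩ := exists_nat_gt (1 / ε)
  have hp0 : 0 < p := by
    have : (0 : ℝ) < p := (by positivity : (0 : ℝ) < 1 / ε).trans hp
    exact_mod_cast this
  have hpε : 1 < ε * (2 * p) := by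
    rw [div_lt_iff₀ hε] at hp
    nlinarith
  obtain ⟨y, hy⟩ := exists_points hδ (fun i => he ▸ Set.mem_range_self i) hp0 hpε
  have havg : ∀ s : ℂ, ‖s‖ = 1 → Tendsto (boxAverage (blockFamily p i₀ s y)) atTop (𝓝 0) := by
    intro s hs
    refine hV _ (norm_blockFamily hs y) fun h hh => ?_
    obtain ⟨i, rfl⟩ : h ∈ Set.range e := he ▸ hh
    exact tendsto_corr_blockFamily hp0 i₀ hs (hy i)
  -- Half the sum of the families for `s = 1` and `s = -1` is the indicator of the initial parts.
  have h1 := ((havg 1 (by simp)).add (havg (-1) (by simp))).const_mul (1 / 2)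
  rw [add_zero, mul_zero] at h1
  refine not_tendsto_boxAverage_initial hp0 i₀ (h1.congr fun N => ?_)
  rw [← boxAverage_add, ← boxAverage_const_mul]
  congr 1
  funext n
  unfold blockFamily
  cases (blockLabel p (n i₀)).2
  · simp
  · norm_num

end Necessity

end

theorem mainTheorem6 (k : ℕ) (H : Set (Fin k → ℤ)) (hH : (0 : Fin k → ℤ) ∉ H) :
    (IsVanDerCorput H ↔ deltaInf H = 0) ∧
    (IsHeilbronn H ↔ gammaSup H = 0) ∧
    (H.Nonempty → gammaSup H ≤ deltaInf H) ∧
    (IsVanDerCorput H → IsHeilbronn H) := by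
  have hδ : IsVanDerCorput H ↔ deltaInf H = 0 := by
    rw [deltaInf_eq_zero_iff hH]
    exact ⟨fun hV => hV.forall_exists_isAdmissible hH, isVanDerCorput_of_forall_exists hH⟩
  refine ⟨hδ, isHeilbronn_iff_gammaSup_eq_zero H, gammaSup_le_deltaInf hH, fun hV => ?_⟩
  rw [isHeilbronn_iff_gammaSup_eq_zero]
  exact le_antisymm ((gammaSup_le_deltaInf hH hV.nonempty).trans_eq (hδ.1 hV)) (gammaSup_nonneg H)
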